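/- Consider $M$ relays and $K\ge 1$ users with SINR targets $\bar\gamma_k>0$, noise standard deviations $\sigma_k>0$, fronthaul capacities $\bar C_m>0$ and channel coefficients $h_{k,m}\in\mathbb C$ from relay $m$ to user $k$. Put $\mathbf h_k=[h_{k,1},\dots,h_{k,M}]^\dagger$, where $\dagger$ is the conjugate transpose. The SDR is the problem of minimizing $\sum_k\mathrm{tr}(\mathbf V_k)+\mathrm{tr}(\mathbf Q)$ over Hermitian positive semidefinite matrices $\mathbf V_1,\dots,\mathbf V_K,\mathbf Q\in\mathbb C^{M\times M}$ subject to $$\frac1{\bar\gamma_k}\mathbf h_k^\dagger\mathbf V_k\mathbf h_k-\sum_{j\ne k}\mathbf h_k^\dagger\mathbf V_j\mathbf h_k-\mathbf h_k^\dagger\mathbf Q\mathbf h_k-\sigma_k^2\ge 0\quad\text{for all }k,$$ $$2^{\bar C_m}\begin{bmatrix}\mathbf 0&\mathbf 0\\ \mathbf 0&\mathbf Q^{(m:M,m:M)}\end{bmatrix}-\Big(\sum_k\mathbf V_k^{(m,m)}+\mathbf Q^{(m,m)}\Big)\mathbf E_m\succeq\mathbf 0\quad\text{for all }m,$$ where $\mathbf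 E_m$ has a single nonzero entry, a $1$ in position $(m,m)$. Fix a relay $r$. The reduced problem (R) is the same problem with relay $r$ deleted: the other relays keep their order, capacities and channels, and the matrices have size $(M-1)\times(M-1)$. Optimal values of infeasible problems are $+\infty$. Let the channels $\{h_{k,m}\}$ be random variables on a probability space such that $\{h_{k,r}\}_k$ is independent of $\{h_{k,m}\}_{k,\;m\ne r}$ and such that almost surely $h_{k,r}\neq0$ for at least one $k$ (as is the case, for instance, for any continuous distribution of $\{h_{k,r}\}_k$). Then, for almost every realization of the channels such that every optimal $\tilde{\mathbf Q}$ of (R) is positive definite, the following hold: (i) if the SDR is feasible, then the optimal values of (R) and of the SDR differ; (ii) if (R) is feasible, then every optimal $\mathbf Q$ of the SDR is positive definite. -/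

import Mathlib

open scoped ComplexOrder

noncomputable section

namespace RelaySDR

/- Users are indexed by `κ`, relays by a finite linearly ordered type `ι`.  The order of the
relays is the one in which the trailing blocks `(m:M, m:M)` are formed.  The same definitions,
applied to a subtype of `ι`, describe the problem in which some relays have been removed. -/
variable {κ ι : Type*} [Fintype κ] [DecidableEq κ] [Fintype ι] [LinearOrder ι]

/-- The channel vector of user `k`: the conjugate transpose of the row `(h k m)_m`. -/
def channelVec (h : κ → ι → ℂ) (k : κ) : ι → ℂ := fun m => star (h k m)

/-- The quadratic form `x† A x`; it is real for Hermitian `A`. -/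
def quadForm (A : Matrix ι ι ℂ) (x : ι → ℂ) : ℝ := (star x ⬝ᵥ A.mulVec x).re

/-- The SINR constraint function `a_k`. -/
def sinrFun (h : κ → ι → ℂ) (γ σ : κ → ℝ) (V : κ → Matrix ι ι ℂ) (Q : Matrix ι ι ℂ) (k : κ) : ℝ :=
  1 / γ k * quadForm (V k) (channelVec h k)
    - ∑ j ∈ Finset.univ.erase k, quadForm (V j) (channelVec h k)
    - quadForm Q (channelVec h k) - σ k ^ 2

/-- The matrix that agrees with `Q` on rows and columns `m, …, M` and is zero elsewhere. -/
def trailingBlock (m : ι) (Q : Matrix ι ι ℂ) : Matrix ι ι ℂ :=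
  Matrix.of fun i j => if m ≤ i ∧ m ≤ j then Q i j else 0

/-- The fronthaul constraint matrix `B_m`. -/
def fronthaulMat (C : ι → ℝ) (V : κ → Matrix ι ι ℂ) (Q : Matrix ι ι ℂ) (m : ι) : Matrix ι ι ℂ :=
  (((2 : ℝ) ^ C m : ℝ) : ℂ) • trailingBlock m Q
    - Matrix.single m m ((∑ k, V k m m) + Q m m)

/-- The total power `∑ₖ tr Vₖ + tr Q`. -/
def power (V : κ → Matrix ι ι ℂ) (Q : Matrix ι ι ℂ) : ℝ :=
  (∑ k, (V k).trace.re) + Q.trace.re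

/-- Feasibility of `({V_k}, Q)` for the semidefinite relaxation. -/
structure IsFeasible (h : κ → ι → ℂ) (γ σ : κ → ℝ) (C : ι → ℝ)
    (V : κ → Matrix ι ι ℂ) (Q : Matrix ι ι ℂ) : Prop where
  posSemidef_V : ∀ k, (V k).PosSemidef
  posSemidef_Q : Q.PosSemidef
  sinr : ∀ k, 0 ≤ sinrFun h γ σ V Q k
  fronthaul : ∀ m, (fronthaulMat C V Q m).PosSemidef

/-- The semidefinite relaxation has a feasible point. -/
def Feasible (h : κ → ι → ℂ) (γ σ : κ → ℝ) (C : ι → ℝ) : Prop :=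
  ∃ (V : κ → Matrix ι ι ℂ) (Q : Matrix ι ι ℂ), IsFeasible h γ σ C V Q

/-- `({V_k}, Q)` is an optimal solution of the semidefinite relaxation. -/
def IsOptimal (h : κ → ι → ℂ) (γ σ : κ → ℝ) (C : ι → ℝ)
    (V : κ → Matrix ι ι ℂ) (Q : Matrix ι ι ℂ) : Prop :=
  IsFeasible h γ σ C V Q ∧
    ∀ (V' : κ → Matrix ι ι ℂ) (Q' : Matrix ι ι ℂ), IsFeasible h γ σ C V' Q' →
      power V Q ≤ power V' Q'

/-- The optimal value of the semidefinite relaxation (`+∞` if it is infeasible). -/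
def optimalValue (h : κ → ι → ℂ) (γ σ : κ → ℝ) (C : ι → ℝ) : EReal :=
  ⨅ (V : κ → Matrix ι ι ℂ) (Q : Matrix ι ι ℂ) (_ : IsFeasible h γ σ C V Q),
    ((power V Q : ℝ) : EReal)

/-- The channels that are left when relay `r` is removed. -/
def removeChannel (r : ι) (h : κ → ι → ℂ) : κ → {m : ι // m ≠ r} → ℂ := fun k m => h k m

/-- The fronthaul capacities that are left when relay `r` is removed. -/
def removeCapacity (r : ι) (C : ι → ℝ) : {m : ι // m ≠ r} → ℝ := fun m => C m

end RelaySDR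

end

namespace RelaySDR

set_option linter.unusedSectionVars false

open Matrix

/-! ### Quadratic forms of complex positive semidefinite matrices -/

section QuadForm

variable {ι : Type*} [Fintype ι]

/-! The heart is `IsOptimal.channel_eq_zero`: at an optimum, `Q r r = 0` forces `h k r = 0` for
every user, because switching the silent relay on would save power. Take rank-one `Vₖ = vₖ vₖ†` and
move each `vⱼ` by `-ε * star βⱼ` along `y - e_r`, where `y = ∑ βⱼ vⱼ` and `βⱼ` is tuned so that the
first-order changes of signal and interference complete a square. With `zₖ = hₖ ⬝ y - h_{k,r}`, SINR
slack grows by about `2ε‖zₖ‖²` and power changes by `-2ε‖y‖²`, while relay `r` needs quantization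
noise only of order `ε²`. If `y ≠ 0`, power drops to first order and the second-order SINR loss is
repaired by scaling (`IsOptimal.mul_power_le`). If `y = 0`, then `zₖ = -h_{k,r}`; a nonzero channel
yields first-order slack, which converts into power (`IsOptimal.power_add_le`). Both contradict
optimality.

The theorem then holds at each realization with some `h_{k,r} ≠ 0`. If the values in (i) agreed, a
zero-extended optimum of (R) would be optimal with `r` silent. In (ii), a feasible `Q` that is not
positive definite has a zero diagonal entry `m` (`IsFeasible.posDef`); relay `m` then has no
channel, so `m ≠ r`, and every optimum of (R) silences `m` too (`IsOptimal.diag_re_eq_zero`),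
contradicting positive definiteness. -/

lemma quadForm_add (A B : Matrix ι ι ℂ) (x : ι → ℂ) :
    quadForm (A + B) x = quadForm A x + quadForm B x := by
  simp [quadForm, add_mulVec, dotProduct_add]

lemma quadForm_sub (A B : Matrix ι ι ℂ) (x : ι → ℂ) :
    quadForm (A - B) x = quadForm A x - quadForm B x := by
  simp [quadForm, sub_mulVec, dotProduct_sub]

lemma quadForm_smul (c : ℝ) (A : Matrix ι ι ℂ) (x : ι → ℂ) :
    quadForm ((c : ℂ) • A) x = c * quadForm A x := by
  simp [quadForm, smul_mulVec, dotProduct_smul]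

lemma quadForm_nonneg {A : Matrix ι ι ℂ} (hA : A.PosSemidef) (x : ι → ℂ) : 0 ≤ quadForm A x :=
  hA.re_dotProduct_nonneg x

lemma ofReal_quadForm {A : Matrix ι ι ℂ} (hA : A.IsHermitian) (x : ι → ℂ) :
    (quadForm A x : ℂ) = star x ⬝ᵥ A *ᵥ x := by
  apply Complex.ext
  · simp [quadForm]
  · have := hA.im_star_dotProduct_mulVec_self x
    simpa using this.symm

lemma posSemidef_iff_quadForm {A : Matrix ι ι ℂ} :
    A.PosSemidef ↔ A.IsHermitian ∧ ∀ x, 0 ≤ quadForm A x := by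
  refine ⟨fun h => ⟨h.1, quadForm_nonneg h⟩, fun h => ?_⟩
  refine .of_dotProduct_mulVec_nonneg h.1 fun x => ?_
  rw [← ofReal_quadForm h.1]
  exact_mod_cast h.2 x

lemma posDef_iff_quadForm {A : Matrix ι ι ℂ} (hA : A.PosSemidef) :
    A.PosDef ↔ ∀ x, quadForm A x = 0 → x = 0 := by
  refine ⟨fun h x hx => ?_, fun h => .of_dotProduct_mulVec_pos hA.1 fun x hx => ?_⟩
  · by_contra hne
    exact (h.re_dotProduct_pos hne).ne' hx
  · rw [← ofReal_quadForm hA.1]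
    exact_mod_cast (quadForm_nonneg hA x).lt_of_ne' fun h0 => hx (h x h0)

/-- Evaluated at `star x` because channel vectors are conjugated rows of `h`; received powers become
`‖h k ⬝ᵥ v‖ ^ 2`. -/
lemma quadForm_vecMulVec (v x : ι → ℂ) :
    quadForm (vecMulVec v (star v)) (star x) = ‖x ⬝ᵥ v‖ ^ 2 := by
  have h1 : star v ⬝ᵥ star x = star (x ⬝ᵥ v) := (star_dotProduct_star v x)
  rw [quadForm, vecMulVec_mulVec, star_star, dotProduct_smul, h1, op_smul_eq_smul,
    smul_eq_mul, Complex.star_def, Complex.conj_mul']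
  norm_cast

lemma quadForm_congr {κ : Type*} [Fintype κ] (A : Matrix κ κ ℂ) (P : Matrix ι κ ℂ) (x : ι → ℂ) :
    quadForm (P * A * Pᴴ) x = quadForm A (Pᴴ *ᵥ x) := by
  rw [quadForm, quadForm, star_mulVec, conjTranspose_conjTranspose, ← dotProduct_mulVec,
    mulVec_mulVec, mulVec_mulVec, Matrix.mul_assoc]

lemma norm_dotProduct_mulVec_sq_le {A : Matrix ι ι ℂ} (hA : A.PosSemidef) (x y : ι → ℂ) :
    ‖star x ⬝ᵥ A *ᵥ y‖ ^ 2 ≤ quadForm A x * quadForm A y := by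
  let _ := A.toSeminormedAddCommGroup hA
  let _ := A.toInnerProductSpace hA
  have h := inner_mul_inner_self_le (𝕜 := ℂ) x y
  have h1 (u z : ι → ℂ) : inner ℂ u z = star u ⬝ᵥ A *ᵥ z := dotProduct_comm _ _
  rw [norm_inner_symm y x, ← sq, h1, h1, h1] at h
  exact h

/-- Take `v = A y / √(y† A y)`; the domination is Cauchy–Schwarz for the semi-inner product of `A`.
If `y† A y = 0`, then `v = 0` works. -/
lemma exists_vecMulVec_le {A : Matrix ι ι ℂ} (hA : A.PosSemidef) (y : ι → ℂ) :
    ∃ v : ι → ℂ, quadForm (vecMulVec v (star v)) y = quadForm A y ∧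
      ∀ x, quadForm (vecMulVec v (star v)) x ≤ quadForm A x := by
  rcases (quadForm_nonneg hA y).eq_or_lt with h0 | h0
  · exact ⟨0, by rw [← h0]; simp [quadForm], fun x => by simpa [quadForm] using quadForm_nonneg hA x⟩
  have key (x : ι → ℂ) : quadForm (vecMulVec (((√(quadForm A y))⁻¹ : ℂ) • A *ᵥ y)
      (star (((√(quadForm A y))⁻¹ : ℂ) • A *ᵥ y))) x
        = ‖star x ⬝ᵥ A *ᵥ y‖ ^ 2 / quadForm A y := by
    conv_lhs => rw [← star_star x, quadForm_vecMulVec, dotProduct_smul, norm_smul, mul_pow]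
    have : ‖((√(quadForm A y))⁻¹ : ℂ)‖ ^ 2 = (quadForm A y)⁻¹ := by
      rw [norm_inv, Complex.norm_real, Real.norm_eq_abs, inv_pow, sq_abs, Real.sq_sqrt h0.le]
    rw [this]; ring
  refine ⟨((√(quadForm A y))⁻¹ : ℂ) • A *ᵥ y, ?_, fun x => ?_⟩
  · rw [key, ← ofReal_quadForm hA.1, Complex.norm_real, Real.norm_eq_abs, sq_abs]
    field_simp
  · rw [key, div_le_iff₀ h0]
    exact norm_dotProduct_mulVec_sq_le hA x y

variable [DecidableEq ι]

lemma star_single_one (m : ι) : star (Pi.single m 1 : ι → ℂ) = Pi.single m 1 := by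
  ext i; by_cases h : i = m <;> simp [h]

lemma quadForm_single (A : Matrix ι ι ℂ) (m : ι) : quadForm A (Pi.single m 1) = (A m m).re := by
  simp [quadForm]

lemma diag_re_nonneg {A : Matrix ι ι ℂ} (hA : A.PosSemidef) (m : ι) : 0 ≤ (A m m).re := by
  rw [← quadForm_single]; exact quadForm_nonneg hA _

lemma norm_apply_sq_le {A : Matrix ι ι ℂ} (hA : A.PosSemidef) (i j : ι) :
    ‖A i j‖ ^ 2 ≤ (A i i).re * (A j j).re := by
  have h := norm_dotProduct_mulVec_sq_le hA (Pi.single i 1) (Pi.single j 1)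
  rw [quadForm_single, quadForm_single] at h
  simpa [star_single_one] using h

lemma quadForm_matrix_single (m : ι) (c : ℂ) (x : ι → ℂ) :
    quadForm (Matrix.single m m c) x = c.re * ‖x m‖ ^ 2 := by
  have : star x ⬝ᵥ (Matrix.single m m c) *ᵥ x = c * (star (x m) * x m) := by
    rw [show (Matrix.single m m c) *ᵥ x = Pi.single m (c * x m) from single_mulVec m m c x,
      dotProduct_single]
    simp; ring
  rw [quadForm, this, Complex.star_def, Complex.conj_mul', ← Complex.ofReal_pow, Complex.re_mul_ofReal]

lemma trace_re_eq_sum_quadForm (A : Matrix ι ι ℂ) :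
    A.trace.re = ∑ m, quadForm A (Pi.single m 1) := by
  simp [quadForm_single, trace]

lemma trace_re_nonneg {A : Matrix ι ι ℂ} (hA : A.PosSemidef) : 0 ≤ A.trace.re := by
  rw [trace_re_eq_sum_quadForm]
  exact Finset.sum_nonneg fun _ _ => quadForm_nonneg hA _

lemma quadForm_le_trace {A : Matrix ι ι ℂ} (hA : A.PosSemidef) (x : ι → ℂ) :
    quadForm A x ≤ A.trace.re * ∑ m, ‖x m‖ ^ 2 := by
  have h0 (i : ι) : 0 ≤ (A i i).re := diag_re_nonneg hA i
  have h3 (i j : ι) : ‖A i j‖ ≤ √(A i i).re * √(A j j).re := by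
    rw [← Real.sqrt_mul (h0 i)]
    exact Real.le_sqrt_of_sq_le (norm_apply_sq_le hA i j)
  calc quadForm A x ≤ ‖star x ⬝ᵥ A *ᵥ x‖ := Complex.re_le_norm _
    _ ≤ ∑ i, ∑ j, ‖x i‖ * (√(A i i).re * √(A j j).re * ‖x j‖) := by
      refine (norm_sum_le _ _).trans (Finset.sum_le_sum fun i _ => ?_)
      rw [norm_mul, Pi.star_apply, norm_star, ← Finset.mul_sum]
      gcongr
      refine (norm_sum_le _ _).trans (Finset.sum_le_sum fun j _ => ?_)
      rw [norm_mul]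
      gcongr
      exact h3 i j
    _ = (∑ i, √(A i i).re * ‖x i‖) ^ 2 := by
      rw [sq, Finset.sum_mul_sum]
      refine Finset.sum_congr rfl fun i _ => Finset.sum_congr rfl fun j _ => by ring
    _ ≤ (∑ i, √(A i i).re ^ 2) * ∑ i, ‖x i‖ ^ 2 := Finset.sum_mul_sq_le_sq_mul_sq _ _ _
    _ = A.trace.re * ∑ m, ‖x m‖ ^ 2 := by
      simp only [Real.sq_sqrt (h0 _)]
      simp [trace]

lemma norm_apply_le_trace {A : Matrix ι ι ℂ} (hA : A.PosSemidef) (i j : ι) :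
    ‖A i j‖ ≤ A.trace.re := by
  have h0 (k : ι) : 0 ≤ (A k k).re := diag_re_nonneg hA k
  have h1 (k : ι) : (A k k).re ≤ A.trace.re := by
    rw [trace, Complex.re_sum]
    exact Finset.single_le_sum (f := fun i => (A i i).re) (fun i _ => h0 i) (Finset.mem_univ k)
  refine (abs_le_of_sq_le_sq' ((norm_apply_sq_le hA i j).trans ?_) ((h0 i).trans (h1 i))).2
  rw [sq]
  exact mul_le_mul (h1 i) (h1 j) (h0 j) ((h0 i).trans (h1 i))

end QuadForm

/-! ### Scalar form of the constraints, and scaling arguments -/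

section Feasibility

variable {κ ι : Type*} [Fintype κ] [DecidableEq κ] [Fintype ι] [LinearOrder ι]

/-- The vector that agrees with `x` on the entries `m, …, M` and is zero elsewhere. -/
def maskFrom (m : ι) (x : ι → ℂ) : ι → ℂ := fun i => if m ≤ i then x i else 0

/-- The power transmitted by relay `m`. -/
def relayPower (V : κ → Matrix ι ι ℂ) (Q : Matrix ι ι ℂ) (m : ι) : ℝ :=
  (∑ k, (V k m m).re) + (Q m m).re

lemma power_eq_sum_relayPower (V : κ → Matrix ι ι ℂ) (Q : Matrix ι ι ℂ) :
    power V Q = ∑ m, relayPower V Q m := by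
  simp only [power, relayPower, trace, Matrix.diag, Complex.re_sum, Finset.sum_add_distrib]
  rw [Finset.sum_comm]

lemma quadForm_trailingBlock (m : ι) (Q : Matrix ι ι ℂ) (x : ι → ℂ) :
    quadForm (trailingBlock m Q) x = quadForm Q (maskFrom m x) := by
  simp only [quadForm, dotProduct, mulVec, Pi.star_apply, trailingBlock, maskFrom, of_apply]
  congr 1
  refine Finset.sum_congr rfl fun i _ => ?_
  by_cases hi : m ≤ i <;> simp [hi]

lemma quadForm_fronthaulMat (C : ι → ℝ) (V : κ → Matrix ι ι ℂ) (Q : Matrix ι ι ℂ) (m : ι)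
    (x : ι → ℂ) :
    quadForm (fronthaulMat C V Q m) x =
      2 ^ C m * quadForm Q (maskFrom m x) - relayPower V Q m * ‖x m‖ ^ 2 := by
  rw [fronthaulMat, quadForm_sub, quadForm_smul, quadForm_trailingBlock, quadForm_matrix_single,
    relayPower, Complex.add_re, Complex.re_sum]

/-- Testing against vectors makes the fronthaul constraint a scalar comparison with the power of
relay `m`, the form used in all later arguments. -/
lemma fronthaulMat_posSemidef_iff {C : ι → ℝ} {V : κ → Matrix ι ι ℂ} {Q : Matrix ι ι ℂ}
    (hV : ∀ k, (V k).PosSemidef) (hQ : Q.PosSemidef) (m : ι) :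
    (fronthaulMat C V Q m).PosSemidef ↔
      ∀ x : ι → ℂ, relayPower V Q m * ‖x m‖ ^ 2 ≤ 2 ^ C m * quadForm Q (maskFrom m x) := by
  rw [posSemidef_iff_quadForm, and_iff_right]
  · simp only [quadForm_fronthaulMat, sub_nonneg]
  · have h1 : (trailingBlock m Q).IsHermitian := by
      ext i j
      by_cases hi : m ≤ i <;> by_cases hj : m ≤ j <;>
        simp [trailingBlock, hi, hj, ← hQ.1.apply i j]
    have h2 (k : κ) : star (V k m m) = V k m m := (hV k).1.apply m m
    refine IsHermitian.sub (h1.smul ?_) ?_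
    · simp [IsSelfAdjoint]
    · rw [IsHermitian, conjTranspose_single, star_add, star_sum, hQ.1.apply]
      simp only [h2]

lemma isFeasible_iff {h : κ → ι → ℂ} {γ σ : κ → ℝ} {C : ι → ℝ} {V : κ → Matrix ι ι ℂ}
    {Q : Matrix ι ι ℂ} :
    IsFeasible h γ σ C V Q ↔ (∀ k, (V k).PosSemidef) ∧ Q.PosSemidef ∧
      (∀ k, 0 ≤ sinrFun h γ σ V Q k) ∧
      ∀ m x, relayPower V Q m * ‖x m‖ ^ 2 ≤ 2 ^ C m * quadForm Q (maskFrom m x) :=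
  ⟨fun H => ⟨H.1, H.2, H.3, fun m => (fronthaulMat_posSemidef_iff H.1 H.2 m).1 (H.4 m)⟩,
    fun H => ⟨H.1, H.2.1, H.2.2.1,
      fun m => (fronthaulMat_posSemidef_iff H.1 H.2.1 m).2 (H.2.2.2 m)⟩⟩

lemma channelVec_eq (h : κ → ι → ℂ) (k : κ) : channelVec h k = star (h k) := rfl

lemma posSemidef_ofReal_smul {A : Matrix ι ι ℂ} (hA : A.PosSemidef) {t : ℝ} (ht : 0 ≤ t) :
    ((t : ℂ) • A).PosSemidef :=
  hA.smul (by exact_mod_cast ht)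

variable {h : κ → ι → ℂ} {γ σ : κ → ℝ} {C : ι → ℝ} {V : κ → Matrix ι ι ℂ} {Q : Matrix ι ι ℂ}

/-- Replacing each `Vₖ` by a smaller matrix with the same signal power keeps feasibility. -/
lemma IsFeasible.mono (hf : IsFeasible h γ σ C V Q) {W : κ → Matrix ι ι ℂ}
    (hW : ∀ k, (W k).PosSemidef) (hle : ∀ k x, quadForm (W k) x ≤ quadForm (V k) x)
    (hs : ∀ k, 0 ≤ sinrFun h γ σ W Q k) : IsFeasible h γ σ C W Q := by
  obtain ⟨-, hQ, -, hfr⟩ := isFeasible_iff.1 hf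
  refine isFeasible_iff.2 ⟨hW, hQ, hs, fun m x => le_trans ?_ (hfr m x)⟩
  have h1 (k : κ) : (W k m m).re ≤ (V k m m).re := by
    rw [← quadForm_single, ← quadForm_single]
    exact hle k _
  exact mul_le_mul_of_nonneg_right
    (add_le_add_left (Finset.sum_le_sum fun k _ => h1 k) _) (sq_nonneg _)

lemma power_mono {W : κ → Matrix ι ι ℂ}
    (hle : ∀ k x, quadForm (W k) x ≤ quadForm (V k) x) : power W Q ≤ power V Q := by
  refine add_le_add_left (Finset.sum_le_sum fun k _ => ?_) _
  rw [trace_re_eq_sum_quadForm, trace_re_eq_sum_quadForm]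
  exact Finset.sum_le_sum fun m _ => hle k _

/-- Beamforming matrices can be taken of rank one without increasing the power. -/
lemma IsFeasible.exists_rankOne (hf : IsFeasible h γ σ C V Q) :
    ∃ v : κ → ι → ℂ, IsFeasible h γ σ C (fun k => vecMulVec (v k) (star (v k))) Q ∧
      power (fun k => vecMulVec (v k) (star (v k))) Q ≤ power V Q := by
  -- Equality is imposed at user `k`'s own channel, so its signal is kept while interference at the
  -- others can only fall.
  choose v hv hle using fun k => exists_vecMulVec_le (hf.posSemidef_V k) (channelVec h k)
  refine ⟨v, hf.mono (fun k => posSemidef_vecMulVec_self_star _) hle fun k => ?_,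
    power_mono hle⟩
  refine (hf.sinr k).trans ?_
  unfold sinrFun
  rw [hv k]
  gcongr with j _
  exact hle j _

/-- Scaling: a point that meets the SINR constraints for noise powers `t σₖ²` has at least `t`
times the optimal power. -/
lemma IsOptimal.mul_power_le {V' : κ → Matrix ι ι ℂ} {Q' : Matrix ι ι ℂ}
    (hopt : IsOptimal h γ σ C V Q) {t : ℝ} (ht : 0 < t)
    (hV' : ∀ k, (V' k).PosSemidef) (hQ' : Q'.PosSemidef)
    (hs : ∀ k, (t - 1) * σ k ^ 2 ≤ sinrFun h γ σ V' Q' k)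
    (hfr : ∀ m x, relayPower V' Q' m * ‖x m‖ ^ 2 ≤ 2 ^ C m * quadForm Q' (maskFrom m x)) :
    t * power V Q ≤ power V' Q' := by
  have hp : power (fun k => ((t⁻¹ : ℝ) : ℂ) • V' k) (((t⁻¹ : ℝ) : ℂ) • Q')
      = t⁻¹ * power V' Q' := by
    simp only [power, trace_smul, smul_eq_mul, Complex.re_ofReal_mul, mul_add, Finset.mul_sum]
  have hr (m : ι) : relayPower (fun k => ((t⁻¹ : ℝ) : ℂ) • V' k) (((t⁻¹ : ℝ) : ℂ) • Q') m
      = t⁻¹ * relayPower V' Q' m := by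
    simp only [relayPower, Matrix.smul_apply, smul_eq_mul, Complex.re_ofReal_mul, mul_add,
      Finset.mul_sum]
  have ht' : 0 ≤ t⁻¹ := inv_nonneg.2 ht.le
  have h := hopt.2 _ _ (isFeasible_iff.2
    ⟨fun k => posSemidef_ofReal_smul (hV' k) ht', posSemidef_ofReal_smul hQ' ht', fun k => ?_,
      fun m x => ?_⟩)
  · rw [hp] at h
    calc t * power V Q ≤ t * (t⁻¹ * power V' Q') := by gcongr
      _ = power V' Q' := by field_simp
  · have := hs k
    have h2 : sinrFun h γ σ (fun k => ((t⁻¹ : ℝ) : ℂ) • V' k) (((t⁻¹ : ℝ) : ℂ) • Q') k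
        = t⁻¹ * (sinrFun h γ σ V' Q' k - (t - 1) * σ k ^ 2) := by
      simp only [sinrFun, quadForm_smul, ← Finset.mul_sum]
      field_simp
      ring
    rw [h2]
    exact mul_nonneg ht' (sub_nonneg.2 this)
  · rw [hr, quadForm_smul]
    have := mul_le_mul_of_nonneg_left (hfr m x) ht'
    linarith

/-- Slack in one SINR constraint can be traded for power. -/
lemma IsOptimal.power_add_le {V' : κ → Matrix ι ι ℂ} {Q' : Matrix ι ι ℂ}
    (hopt : IsOptimal h γ σ C V Q) (hγ : ∀ k, 0 < γ k) (hσ : ∀ k, 0 < σ k)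
    (hf : IsFeasible h γ σ C V' Q') (k₀ : κ) :
    power V Q + sinrFun h γ σ V' Q' k₀ * γ k₀ / ∑ m, ‖h k₀ m‖ ^ 2 ≤ power V' Q' := by
  set s := sinrFun h γ σ V' Q' k₀ with hs_def
  set q := quadForm (V' k₀) (channelVec h k₀) with hq_def
  have hs : 0 ≤ s := hf.sinr k₀
  have hI (k : κ) : 0 ≤ ∑ j ∈ Finset.univ.erase k, quadForm (V' j) (channelVec h k) :=
    Finset.sum_nonneg fun j _ => quadForm_nonneg (hf.posSemidef_V j) _
  have hq : s * γ k₀ < q := by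
    have h1 : s = 1 / γ k₀ * q - _ - _ - _ := rfl
    have h2 := hI k₀
    have h3 := quadForm_nonneg hf.posSemidef_Q (channelVec h k₀)
    have h4 := sq_pos_of_pos (hσ k₀)
    have h5 : s < 1 / γ k₀ * q := by linarith
    have := hγ k₀
    calc s * γ k₀ < 1 / γ k₀ * q * γ k₀ := by gcongr
      _ = q := by field_simp
  have hq0 : 0 < q := (mul_nonneg hs (hγ k₀).le).trans_lt hq
  -- Shrinking `V' k₀` by `t` consumes exactly the slack: `t * q / γ k₀ = q / γ k₀ - s`.
  set t : ℝ := 1 - s * γ k₀ / q with ht_def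
  have hδ : 0 ≤ s * γ k₀ / q := div_nonneg (mul_nonneg hs (hγ k₀).le) hq0.le
  have ht0 : 0 ≤ t := by
    have : s * γ k₀ / q ≤ 1 := (div_le_one hq0).2 hq.le
    linarith
  have ht1 : t ≤ 1 := by linarith
  set W : κ → Matrix ι ι ℂ := Function.update V' k₀ ((t : ℂ) • V' k₀) with hW_def
  have hW0 : W k₀ = (t : ℂ) • V' k₀ := by simp [hW_def]
  have hWk {k : κ} (hk : k ≠ k₀) : W k = V' k := by simp [hW_def, hk]
  have hle (k : κ) (x : ι → ℂ) : quadForm (W k) x ≤ quadForm (V' k) x := by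
    by_cases hk : k = k₀
    · subst hk
      rw [hW0, quadForm_smul]
      exact mul_le_of_le_one_left (quadForm_nonneg (hf.posSemidef_V k) x) ht1
    · rw [hWk hk]
  have hfW : IsFeasible h γ σ C W Q' := by
    refine hf.mono (fun k => ?_) hle fun k => ?_
    · by_cases hk : k = k₀
      · subst hk
        rw [hW0]
        exact posSemidef_ofReal_smul (hf.posSemidef_V k) ht0
      · rw [hWk hk]
        exact hf.posSemidef_V k
    · have hIW : ∑ j ∈ Finset.univ.erase k, quadForm (W j) (channelVec h k)
          ≤ ∑ j ∈ Finset.univ.erase k, quadForm (V' j) (channelVec h k) :=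
        Finset.sum_le_sum fun j _ => hle j _
      by_cases hk : k = k₀
      · subst hk
        have h1 : s = 1 / γ k * q - _ - _ - _ := rfl
        have h2 : 1 / γ k * quadForm (W k) (channelVec h k) = 1 / γ k * q - s := by
          rw [hW0, quadForm_smul, ht_def, ← hq_def]
          have := (hγ k).ne'
          field_simp
        unfold sinrFun
        rw [h2]
        linarith
      · have h1 := hf.sinr k
        unfold sinrFun at h1 ⊢
        rw [hWk hk]
        linarith
  have hpow : power W Q' = power V' Q' - s * γ k₀ / q * (V' k₀).trace.re := by
    have h1 : ∑ k, (W k).trace.re = t * (V' k₀).trace.re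
        + ∑ k ∈ Finset.univ.erase k₀, (V' k).trace.re := by
      rw [← Finset.add_sum_erase _ _ (Finset.mem_univ k₀), hW0, trace_smul, smul_eq_mul,
        Complex.re_ofReal_mul]
      congr 1
      exact Finset.sum_congr rfl fun k hk => by rw [hWk (Finset.ne_of_mem_erase hk)]
    rw [power, power, h1, ← Finset.add_sum_erase _ (fun k => (V' k).trace.re) (Finset.mem_univ k₀),
      ht_def]
    ring
  have h1 := hopt.2 W Q' hfW
  rw [hpow] at h1
  -- The saved power is bounded below through `q ≤ tr (V' k₀) * ‖h k₀‖²`.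
  have h2 : s * γ k₀ / ∑ m, ‖h k₀ m‖ ^ 2 ≤ s * γ k₀ / q * (V' k₀).trace.re := by
    have h3 := quadForm_le_trace (hf.posSemidef_V k₀) (channelVec h k₀)
    have h4 : ∑ m, ‖channelVec h k₀ m‖ ^ 2 = ∑ m, ‖h k₀ m‖ ^ 2 := by simp [channelVec]
    rw [h4] at h3
    have h5 : 0 < ∑ m, ‖h k₀ m‖ ^ 2 := by
      refine (Finset.sum_nonneg fun m _ => by positivity).lt_of_ne' fun h0 => ?_
      rw [h0, mul_zero] at h3
      exact absurd hq0 h3.not_gt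
    rw [div_mul_eq_mul_div, div_le_div_iff₀ h5 hq0, mul_assoc (s * γ k₀)]
    exact mul_le_mul_of_nonneg_left h3 (mul_nonneg hs (hγ k₀).le)
  linarith

end Feasibility

/-- Serves both relay powers (`a j = v j m`) and received powers (`a j = h k ⬝ᵥ v j`): the linear
term only sees `∑ j, β j * a j`, a coordinate of `y` or its received value. -/
lemma sum_norm_sub_mul_sq {κ : Type*} [Fintype κ] (a β : κ → ℂ) (z : ℂ) (ε : ℝ) :
    ∑ j, ‖a j - ε * star (β j) * z‖ ^ 2 = ∑ j, ‖a j‖ ^ 2 - 2 * ε * (star (∑ j, β j * a j) * z).re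
      + ε ^ 2 * (∑ j, ‖β j‖ ^ 2) * ‖z‖ ^ 2 := by
  have h1 (j : κ) : ‖a j - ε * star (β j) * z‖ ^ 2
      = ‖a j‖ ^ 2 - 2 * ε * (star (β j * a j) * z).re + ε ^ 2 * ‖β j‖ ^ 2 * ‖z‖ ^ 2 := by
    simp only [← Complex.normSq_eq_norm_sq, Complex.normSq_apply, Complex.star_def, map_mul,
      Complex.sub_re, Complex.sub_im, Complex.mul_re, Complex.mul_im, Complex.conj_re,
      Complex.conj_im, Complex.ofReal_re, Complex.ofReal_im]
    ring
  simp only [h1, Finset.sum_add_distrib, Finset.sum_sub_distrib, star_sum, Finset.sum_mul,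
    Complex.re_sum, Finset.mul_sum]

/-! ### Switching on a silent relay -/

section Core

variable {κ ι : Type*} [Fintype κ] [DecidableEq κ] [Fintype ι] [LinearOrder ι]
  {h : κ → ι → ℂ} {γ σ : κ → ℝ} {C : ι → ℝ} {V : κ → Matrix ι ι ℂ} {Q : Matrix ι ι ℂ}

lemma sinrFun_rankOne (v : κ → ι → ℂ) (Q : Matrix ι ι ℂ) (k : κ) :
    sinrFun h γ σ (fun k => vecMulVec (v k) (star (v k))) Q k =
      (1 + 1 / γ k) * ‖h k ⬝ᵥ v k‖ ^ 2 - ∑ j, ‖h k ⬝ᵥ v j‖ ^ 2 - quadForm Q (channelVec h k)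
        - σ k ^ 2 := by
  rw [sinrFun, channelVec_eq]
  simp only [quadForm_vecMulVec]
  rw [← Finset.add_sum_erase _ _ (Finset.mem_univ k)]
  ring

lemma vecMulVec_star_diag_re (v : ι → ℂ) (m : ι) :
    (vecMulVec v (star v) m m).re = ‖v m‖ ^ 2 := by
  rw [vecMulVec_apply, Pi.star_apply, Complex.star_def, Complex.mul_conj', ← Complex.ofReal_pow,
    Complex.ofReal_re]

lemma relayPower_rankOne (v : κ → ι → ℂ) (Q : Matrix ι ι ℂ) (m : ι) :
    relayPower (fun k => vecMulVec (v k) (star (v k))) Q m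
      = ∑ k, ‖v k m‖ ^ 2 + (Q m m).re := by
  simp only [relayPower, vecMulVec_star_diag_re]

lemma relayPower_nonneg (hV : ∀ k, (V k).PosSemidef) (hQ : Q.PosSemidef) (m : ι) :
    0 ≤ relayPower V Q m :=
  add_nonneg (Finset.sum_nonneg fun k _ => diag_re_nonneg (hV k) m) (diag_re_nonneg hQ m)

/-- A relay with no quantization noise does not transmit. -/
lemma IsFeasible.relayPower_eq_zero (hf : IsFeasible h γ σ C V Q) {m : ι} (hm : Q m m = 0) :
    relayPower V Q m = 0 := by
  have h1 := (isFeasible_iff.1 hf).2.2.2 m (Pi.single m 1)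
  have h2 : maskFrom m (Pi.single m 1) = Pi.single m 1 := by
    ext i
    by_cases hi : i = m
    · subst hi; simp [maskFrom]
    · simp [maskFrom, hi]
  rw [h2, quadForm_single, hm] at h1
  simp only [Pi.single_eq_same, norm_one, one_pow, mul_one, Complex.zero_re, mul_zero] at h1
  exact h1.antisymm (relayPower_nonneg hf.posSemidef_V hf.posSemidef_Q m)

/-- Switching on a silent relay `r`: to first order every SINR improves by at least
`‖hₖ y - h_{k,r}‖²`, while the power changes by `-2 ‖y‖²`. -/
lemma IsFeasible.exists_perturbation (hγ : ∀ k, 0 < γ k) (hσ : ∀ k, 0 < σ k) {r : ι}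
    (hC : 0 < C r) {v : κ → ι → ℂ}
    (hf : IsFeasible h γ σ C (fun k => vecMulVec (v k) (star (v k))) Q) (hQr : Q r r = 0) :
    ∃ (y : ι → ℂ) (c B ε₀ : ℝ), 0 ≤ c ∧ 0 < ε₀ ∧ ∀ ε, 0 < ε → ε ≤ ε₀ →
      ∃ (V' : κ → Matrix ι ι ℂ) (Q' : Matrix ι ι ℂ), (∀ k, (V' k).PosSemidef) ∧ Q'.PosSemidef ∧
        (∀ m x, relayPower V' Q' m * ‖x m‖ ^ 2 ≤ 2 ^ C m * quadForm Q' (maskFrom m x)) ∧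
        (∀ k, ε * ‖h k ⬝ᵥ y - h k r‖ ^ 2 - ε ^ 2 * c * ‖h k r‖ ^ 2 ≤ sinrFun h γ σ V' Q' k) ∧
        power V' Q' ≤ power (fun k => vecMulVec (v k) (star (v k))) Q
          - 2 * ε * (∑ m, ‖y m‖ ^ 2) + ε ^ 2 * B := by
  obtain ⟨-, hQ, hs, hfr⟩ := isFeasible_iff.1 hf
  have hvr (j : κ) : v j r = 0 := by
    have h1 := hf.relayPower_eq_zero hQr
    rw [relayPower_rankOne, hQr, Complex.zero_re, add_zero,
      Finset.sum_eq_zero_iff_of_nonneg fun _ _ => by positivity] at h1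
    simpa using h1 j (Finset.mem_univ j)
  -- Positive noise forces a nonzero signal, so dividing by it in `β` is legitimate.
  have hG (k : κ) : h k ⬝ᵥ v k ≠ 0 := fun h0 => by
    have h1 := hs k
    rw [sinrFun_rankOne, h0, norm_zero] at h1
    have h2 : 0 ≤ ∑ j, ‖h k ⬝ᵥ v j‖ ^ 2 := Finset.sum_nonneg fun _ _ => by positivity
    have h3 := quadForm_nonneg hQ (channelVec h k)
    have h4 := sq_pos_of_pos (hσ k)
    linarith
  set β : κ → ℂ := fun k => h k r / (((1 + 1 / γ k : ℝ) : ℂ) * (h k ⬝ᵥ v k)) with hβ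
  have hγ1 (k : κ) : (0 : ℝ) < 1 + 1 / γ k := by have := hγ k; positivity
  have hβG (k : κ) : ((1 + 1 / γ k : ℝ) : ℂ) * (β k * (h k ⬝ᵥ v k)) = h k r := by
    have h1 : ((1 + 1 / γ k : ℝ) : ℂ) ≠ 0 := by exact_mod_cast (hγ1 k).ne'
    have h2 := hG k
    simp only [hβ]
    field_simp
  set b : ℝ := ∑ j, ‖β j‖ ^ 2 with hb
  have hb0 : 0 ≤ b := Finset.sum_nonneg fun _ _ => by positivity
  have hC1 : (1 : ℝ) < 2 ^ C r := Real.one_lt_rpow (by norm_num) hC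
  -- The solution of `b + c = 2 ^ C r * c`: relay `r` will transmit `ε² (b + c)` with noise `ε² c`,
  -- just meeting its fronthaul constraint.
  set c : ℝ := b / (2 ^ C r - 1) with hc
  have hc0 : 0 ≤ c := div_nonneg hb0 (by linarith)
  have hbc : b + c = 2 ^ C r * c := by
    have : (2 : ℝ) ^ C r - 1 ≠ 0 := by linarith
    rw [hc]; field_simp; ring
  set y : ι → ℂ := ∑ j, β j • v j with hy
  have hyr : y r = 0 := by simp [hy, Finset.sum_apply, hvr]
  have hym (m : ι) : y m = ∑ j, β j * v j m := by simp [hy, Finset.sum_apply]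
  have hyk (k : κ) : h k ⬝ᵥ y = ∑ j, β j * (h k ⬝ᵥ v j) := by
    simp [hy, dotProduct_sum, dotProduct_smul]
  -- The bound on `ε` gives `ε * b ≤ 1`, so the quadratic terms cost at most half of the first-order
  -- gain.
  refine ⟨y, c, b * (∑ m, ‖y m‖ ^ 2) + b + c, 1 / (b + 1), hc0, by positivity, ?_⟩
  intro ε hε hε1
  have hεb : ε * b ≤ 1 := by
    calc ε * b ≤ 1 / (b + 1) * b := by gcongr
      _ ≤ 1 := by rw [one_div_mul_eq_div]; exact (div_le_one (by linarith)).2 (by linarith)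
  set y' : ι → ℂ := y - Pi.single r 1 with hy'
  set v' : κ → ι → ℂ := fun j => v j - ((ε : ℂ) * star (β j)) • y' with hv'
  set Q' : Matrix ι ι ℂ := Q + Matrix.single r r ((c * ε ^ 2 : ℝ) : ℂ) with hQ'
  have hQ'q (x : ι → ℂ) : quadForm Q' x = quadForm Q x + c * ε ^ 2 * ‖x r‖ ^ 2 := by
    rw [hQ', quadForm_add, quadForm_matrix_single, Complex.ofReal_re]
  have hsing : (Matrix.single r r ((c * ε ^ 2 : ℝ) : ℂ)).IsHermitian := by
    rw [IsHermitian, conjTranspose_single]; simp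
  have hQ'p : Q'.PosSemidef := posSemidef_iff_quadForm.2 ⟨hQ.1.add hsing, fun x => by
    rw [hQ'q]; exact add_nonneg (quadForm_nonneg hQ x) (by positivity)⟩
  have hcol (m : ι) (hm : m ≠ r) : ∑ j, ‖v' j m‖ ^ 2
      = ∑ j, ‖v j m‖ ^ 2 - 2 * ε * ‖y m‖ ^ 2 + ε ^ 2 * b * ‖y m‖ ^ 2 := by
    have h1 := sum_norm_sub_mul_sq (fun j => v j m) β (y m) ε
    rw [← hym, Complex.star_def, Complex.conj_mul', ← Complex.ofReal_pow, Complex.ofReal_re] at h1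
    rw [← h1]
    simp [hv', hy', hm]
  have hcolr : ∑ j, ‖v' j r‖ ^ 2 = ε ^ 2 * b := by
    have h1 := sum_norm_sub_mul_sq (fun j => v j r) β (-1) ε
    rw [← hym, hyr] at h1
    simp only [hvr, norm_neg, norm_one, norm_zero, star_zero, zero_mul, Complex.zero_re] at h1
    simp only [hv', hy', Pi.sub_apply, Pi.smul_apply, hvr, hyr, smul_eq_mul, Pi.single_eq_same,
      zero_sub (1 : ℂ)]
    rw [h1]; simp [hb]
  have hRm (m : ι) (hm : m ≠ r) : relayPower (fun k => vecMulVec (v' k) (star (v' k))) Q' m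
      = relayPower (fun k => vecMulVec (v k) (star (v k))) Q m
        - 2 * ε * ‖y m‖ ^ 2 + ε ^ 2 * b * ‖y m‖ ^ 2 := by
    rw [relayPower_rankOne, relayPower_rankOne, hcol m hm]
    have : Q' m m = Q m m := by simp [hQ', hm.symm]
    rw [this]; ring
  have hRr : relayPower (fun k => vecMulVec (v' k) (star (v' k))) Q' r = ε ^ 2 * (b + c) := by
    rw [relayPower_rankOne, hcolr]
    have : (Q' r r).re = c * ε ^ 2 := by
      rw [hQ', Matrix.add_apply, hQr, zero_add, single_apply_same, Complex.ofReal_re]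
    rw [this]; ring
  refine ⟨fun k => vecMulVec (v' k) (star (v' k)), Q',
    fun k => posSemidef_vecMulVec_self_star _, hQ'p, fun m x => ?_, fun k => ?_, ?_⟩
  · rw [hQ'q]
    by_cases hm : m = r
    · subst hm
      rw [hRr]
      have h1 : maskFrom m x m = x m := by simp [maskFrom]
      have h2 : 0 ≤ (2 : ℝ) ^ C m * quadForm Q (maskFrom m x) :=
        mul_nonneg (by positivity) (quadForm_nonneg hQ _)
      rw [h1, hbc, mul_add]
      linarith
    · rw [hRm m hm]
      have h1 := hfr m x
      have h2 : ε ^ 2 * b * ‖y m‖ ^ 2 ≤ 2 * ε * ‖y m‖ ^ 2 := by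
        have : ε ^ 2 * b ≤ 2 * ε := by nlinarith
        gcongr
      have h3 : (relayPower (fun k => vecMulVec (v k) (star (v k))) Q m
          - 2 * ε * ‖y m‖ ^ 2 + ε ^ 2 * b * ‖y m‖ ^ 2) * ‖x m‖ ^ 2
          ≤ relayPower (fun k => vecMulVec (v k) (star (v k))) Q m * ‖x m‖ ^ 2 := by
        gcongr; linarith
      have h4 : (0 : ℝ) ≤ 2 ^ C m * (c * ε ^ 2 * ‖maskFrom m x r‖ ^ 2) := by positivity
      rw [mul_add]
      linarith
  · have hz : h k ⬝ᵥ y' = h k ⬝ᵥ y - h k r := by simp [hy', dotProduct_sub]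
    have hkv (j : κ) : h k ⬝ᵥ v' j = h k ⬝ᵥ v j - ε * star (β j) * (h k ⬝ᵥ y - h k r) := by
      rw [← hz]; simp [hv', dotProduct_sub, dotProduct_smul]
    have h0 := hs k
    rw [sinrFun_rankOne] at h0 ⊢
    have h1 := sum_norm_sub_mul_sq (fun j => h k ⬝ᵥ v j) β (h k ⬝ᵥ y - h k r) ε
    have h2 := sum_norm_sub_mul_sq (fun _ : Unit => h k ⬝ᵥ v k) (fun _ => β k)
      (h k ⬝ᵥ y - h k r) ε
    simp only [Finset.univ_unique, Finset.sum_singleton] at h2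
    rw [← hyk] at h1
    simp only [hkv]
    rw [h1, h2, hQ'q]
    set z := h k ⬝ᵥ y - h k r with hz_def
    set g := h k ⬝ᵥ y with hg
    have h3 : (1 + 1 / γ k) * (star (β k * (h k ⬝ᵥ v k)) * z).re = (star (h k r) * z).re := by
      rw [← Complex.re_ofReal_mul, ← mul_assoc]
      congr 2
      rw [← hβG k, Complex.star_def, map_mul _ ((1 + 1 / γ k : ℝ) : ℂ), Complex.conj_ofReal]
    -- The square is completed here: interference contributes `g = h k ⬝ᵥ y`, the signal contributes
    -- `h k r` by the choice of `β`, and their difference is `z`.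
    have h4 : (star g * z).re - (star (h k r) * z).re = ‖z‖ ^ 2 := by
      rw [← Complex.sub_re, ← sub_mul, ← star_sub, ← hz_def, Complex.star_def, Complex.conj_mul',
        ← Complex.ofReal_pow, Complex.ofReal_re]
    have h5 : ‖channelVec h k r‖ = ‖h k r‖ := by simp [channelVec]
    have h6 : ε ^ 2 * b * ‖z‖ ^ 2 ≤ ε * ‖z‖ ^ 2 := by
      have : ε ^ 2 * b ≤ ε := by nlinarith
      gcongr
    have h7 : 0 ≤ (1 + 1 / γ k) * (ε ^ 2 * ‖β k‖ ^ 2 * ‖z‖ ^ 2) :=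
      mul_nonneg (hγ1 k).le (by positivity)
    rw [h5]
    have h8 : (1 + 1 / γ k) * (2 * ε * (star (β k * (h k ⬝ᵥ v k)) * z).re)
        = 2 * ε * ((star g * z).re - ‖z‖ ^ 2) := by
      rw [← h4, ← h3]; ring
    rw [mul_add, mul_sub, h8]
    linarith
  · rw [power_eq_sum_relayPower, power_eq_sum_relayPower,
      ← Finset.add_sum_erase _ _ (Finset.mem_univ r), hRr,
      ← Finset.add_sum_erase (Finset.univ : Finset ι)
        (relayPower (fun k => vecMulVec (v k) (star (v k))) Q) (Finset.mem_univ r),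
      hf.relayPower_eq_zero hQr,
      ← Finset.add_sum_erase (Finset.univ : Finset ι) (fun m => ‖y m‖ ^ 2) (Finset.mem_univ r),
      hyr, Finset.sum_congr rfl fun m hm => hRm m (Finset.ne_of_mem_erase hm),
      Finset.sum_add_distrib, Finset.sum_sub_distrib, ← Finset.mul_sum, ← Finset.mul_sum]
    simp only [norm_zero]
    apply le_of_eq
    ring

lemma exists_sq_mul_lt_mul {A B ε₀ : ℝ} (hA : 0 < A) (hε₀ : 0 < ε₀) :
    ∃ ε, 0 < ε ∧ ε ≤ ε₀ ∧ ε ^ 2 * B < ε * A := by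
  refine ⟨min ε₀ (A / (|B| + 1)), by positivity, min_le_left _ _, ?_⟩
  set ε := min ε₀ (A / (|B| + 1))
  have h0 : 0 < ε := by positivity
  have h1 : ε * (|B| + 1) ≤ A := (le_div_iff₀ (by positivity)).1 (min_le_right _ _)
  have h2 : ε * B < A := by nlinarith [le_abs_self B]
  calc ε ^ 2 * B = ε * (ε * B) := by ring
    _ < ε * A := by gcongr

/-- At an optimum, a relay without quantization noise has no channel to any user. -/
theorem IsOptimal.channel_eq_zero (hγ : ∀ k, 0 < γ k) (hσ : ∀ k, 0 < σ k) {r : ι} (hC : 0 < C r)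
    (hopt : IsOptimal h γ σ C V Q) (hQr : Q r r = 0) (k : κ) : h k r = 0 := by
  obtain ⟨v, hf, hp⟩ := hopt.1.exists_rankOne
  obtain ⟨y, c, B, ε₀, hc, hε₀, H⟩ := hf.exists_perturbation hγ hσ hC hQr
  have hP : power V Q = power (fun k => vecMulVec (v k) (star (v k))) Q :=
    (hopt.2 _ _ hf).antisymm hp
  rw [← hP] at H
  have hy : y = 0 := by
    by_contra hy
    have hY : 0 < ∑ m, ‖y m‖ ^ 2 := by
      obtain ⟨m, hm⟩ := Function.ne_iff.1 hy
      exact Finset.sum_pos' (fun _ _ => by positivity)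
        ⟨m, Finset.mem_univ m, pow_pos (norm_pos_iff.2 hm) 2⟩
    -- Large enough that every SINR deficit is at most `ε² D σₖ²`, so scaling with `t = 1 - ε² D`
    -- applies.
    set D := ∑ k, c * ‖h k r‖ ^ 2 / σ k ^ 2 with hD
    have hD0 : 0 ≤ D := Finset.sum_nonneg fun _ _ => by positivity
    obtain ⟨ε, hε, hε1, hlt⟩ := exists_sq_mul_lt_mul (A := 2 * ∑ m, ‖y m‖ ^ 2)
      (B := B + D * power V Q) (ε₀ := min ε₀ (1 / (D + 1))) (by positivity) (by positivity)
    obtain ⟨V', Q', hV', hQ', hfr, hs, hpow⟩ := H ε hε (hε1.trans (min_le_left _ _))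
    have hεD : ε * (D + 1) ≤ 1 :=
      (le_div_iff₀ (by positivity)).1 (hε1.trans (min_le_right _ _))
    have ht : 0 < 1 - ε ^ 2 * D := by nlinarith
    have h1 := hopt.mul_power_le ht hV' hQ' (fun k => ?_) hfr
    · nlinarith
    · have h2 : c * ‖h k r‖ ^ 2 / σ k ^ 2 ≤ D :=
        Finset.single_le_sum (f := fun k => c * ‖h k r‖ ^ 2 / σ k ^ 2)
          (fun _ _ => by positivity) (Finset.mem_univ k)
      rw [div_le_iff₀ (sq_pos_of_pos (hσ k))] at h2
      have h3 := hs k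
      have h4 : 0 ≤ ε * ‖h k ⬝ᵥ y - h k r‖ ^ 2 := by positivity
      have h5 : ε ^ 2 * (c * ‖h k r‖ ^ 2) ≤ ε ^ 2 * (D * σ k ^ 2) := by gcongr
      linarith
  by_contra hk
  subst hy
  simp only [dotProduct_zero, zero_sub, norm_neg, Pi.zero_apply, norm_zero] at H
  have hS : 0 < ∑ m, ‖h k m‖ ^ 2 :=
    Finset.sum_pos' (fun _ _ => by positivity)
      ⟨r, Finset.mem_univ r, pow_pos (norm_pos_iff.2 hk) 2⟩
  have hk' : 0 < ‖h k r‖ := norm_pos_iff.2 hk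
  -- The first-order power saving obtained by trading in user `k`'s slack of at least `(ε - ε² c) ‖h
  -- k r‖²`.
  set A := ‖h k r‖ ^ 2 * γ k / ∑ m, ‖h k m‖ ^ 2 with hA
  have hA0 : 0 < A := div_pos (mul_pos (by positivity) (hγ k)) hS
  obtain ⟨ε, hε, hε1, hlt⟩ := exists_sq_mul_lt_mul (A := A)
      (B := B + c * A) (ε₀ := min ε₀ (1 / (c + 1))) hA0 (by positivity)
  obtain ⟨V', Q', hV', hQ', hfr, hs, hpow⟩ := H ε hε (hε1.trans (min_le_left _ _))
  have hεc : ε * (c + 1) ≤ 1 :=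
    (le_div_iff₀ (by positivity)).1 (hε1.trans (min_le_right _ _))
  have hεc' : ε ^ 2 * c ≤ ε := by nlinarith
  have hf' : IsFeasible h γ σ C V' Q' := isFeasible_iff.2 ⟨hV', hQ', fun j => by
    have h1 : ε ^ 2 * c * ‖h j r‖ ^ 2 ≤ ε * ‖h j r‖ ^ 2 := by gcongr
    linarith [hs j], hfr⟩
  have h1 := hopt.power_add_le hγ hσ hf' k
  have h2 : (ε - ε ^ 2 * c) * A ≤ sinrFun h γ σ V' Q' k * γ k / ∑ m, ‖h k m‖ ^ 2 := by
    rw [hA, ← mul_div_assoc, ← mul_assoc]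
    have := hs k
    have := (hγ k).le
    gcongr
    linarith
  norm_num at hpow
  linarith

end Core

/-! ### Definiteness of `Q` and existence of optima -/

section Existence

variable {κ ι : Type*} [Fintype κ] [DecidableEq κ] [Fintype ι] [LinearOrder ι]
  {h : κ → ι → ℂ} {γ σ : κ → ℝ} {C : ι → ℝ} {V : κ → Matrix ι ι ℂ} {Q : Matrix ι ι ℂ}

/-- If no relay is silent, the quantization noise covariance is positive definite. -/
lemma IsFeasible.posDef (hf : IsFeasible h γ σ C V Q) (hQ : ∀ m, Q m m ≠ 0) : Q.PosDef := by
  refine (posDef_iff_quadForm hf.posSemidef_Q).2 fun x hx => ?_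
  by_contra hne
  obtain ⟨m₀, hm₀⟩ := Function.ne_iff.1 hne
  -- At the first nonzero entry `m` of a null vector `x`, masking leaves `x` unchanged, so the
  -- `m`-th fronthaul constraint bounds a positive number by zero.
  obtain ⟨m, hm⟩ := (Set.toFinite {m | x m ≠ 0}).exists_minimal ⟨m₀, hm₀⟩
  have hmask : maskFrom m x = x := by
    ext i
    by_cases hi : m ≤ i
    · simp [maskFrom, hi]
    · have : x i = 0 := by
        by_contra hxi
        exact hi (hm.le_of_le hxi (not_le.1 hi).le)
      simp [maskFrom, hi, this]
  have h1 := (isFeasible_iff.1 hf).2.2.2 m x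
  rw [hmask, hx, mul_zero] at h1
  have h2 : 0 < (Q m m).re := by
    refine (diag_re_nonneg hf.posSemidef_Q m).lt_of_ne' fun h0 => hQ m ?_
    have := (Complex.nonneg_iff.1 (hf.posSemidef_Q.diag_nonneg (i := m))).2
    exact Complex.ext h0 this.symm
  have h3 : 0 < relayPower V Q m :=
    add_pos_of_nonneg_of_pos
      (Finset.sum_nonneg fun k _ => diag_re_nonneg (hf.posSemidef_V k) m) h2
  have h4 : 0 < ‖x m‖ := norm_pos_iff.2 hm.prop
  exact absurd h1 (not_le.2 (mul_pos h3 (pow_pos h4 2)))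

lemma continuous_quadForm (x : ι → ℂ) : Continuous fun A : Matrix ι ι ℂ => quadForm A x := by
  simp only [quadForm, dotProduct, mulVec]
  fun_prop

lemma isClosed_posSemidef : IsClosed {A : Matrix ι ι ℂ | A.PosSemidef} := by
  simp only [posSemidef_iff_quadForm, Set.ofPred_and, Set.ofPred_forall]
  refine IsClosed.inter ?_ (isClosed_iInter fun x =>
    isClosed_le continuous_const (continuous_quadForm x))
  exact isClosed_eq continuous_id.matrix_conjTranspose continuous_id

lemma isClosed_isFeasible (h : κ → ι → ℂ) (γ σ : κ → ℝ) (C : ι → ℝ) :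
    IsClosed {p : (κ → Matrix ι ι ℂ) × Matrix ι ι ℂ | IsFeasible h γ σ C p.1 p.2} := by
  have hq1 (k : κ) (x : ι → ℂ) :
      Continuous fun p : (κ → Matrix ι ι ℂ) × Matrix ι ι ℂ => quadForm (p.1 k) x :=
    (continuous_quadForm x).comp ((continuous_apply k).comp continuous_fst)
  have hq2 (x : ι → ℂ) :
      Continuous fun p : (κ → Matrix ι ι ℂ) × Matrix ι ι ℂ => quadForm p.2 x :=
    (continuous_quadForm x).comp continuous_snd
  simp only [isFeasible_iff, Set.ofPred_and, Set.ofPred_forall]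
  refine (isClosed_iInter fun k => ?_).inter (IsClosed.inter ?_
    ((isClosed_iInter fun k => ?_).inter (isClosed_iInter fun m => isClosed_iInter fun x => ?_)))
  · have h1 : Continuous fun p : (κ → Matrix ι ι ℂ) × Matrix ι ι ℂ => p.1 k :=
      (continuous_apply k).comp continuous_fst
    exact isClosed_posSemidef.preimage h1
  · exact isClosed_posSemidef.preimage continuous_snd
  · refine isClosed_le continuous_const ?_
    unfold sinrFun
    fun_prop
  · refine isClosed_le ?_ ?_
    · simp only [relayPower, ← quadForm_single]
      fun_prop
    · fun_prop

lemma continuous_power :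
    Continuous fun p : (κ → Matrix ι ι ℂ) × Matrix ι ι ℂ => power p.1 p.2 := by
  simp only [power, trace, Matrix.diag]
  fun_prop

/-- A feasible problem has an optimal solution. -/
theorem Feasible.exists_isOptimal (hF : Feasible h γ σ C) : ∃ V Q, IsOptimal h γ σ C V Q := by
  obtain ⟨V₀, Q₀, h₀⟩ := hF
  -- Plain function types carry the sup norm. The power dominates every entry, so this sublevel set
  -- is compact.
  set S : Set ((κ → ι → ι → ℂ) × (ι → ι → ℂ)) :=
    {p | IsFeasible h γ σ C p.1 p.2 ∧ power (p.1 : κ → Matrix ι ι ℂ) p.2 ≤ power V₀ Q₀} with hS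
  have hclosed : IsClosed S :=
    (isClosed_isFeasible h γ σ C).inter (isClosed_le continuous_power continuous_const)
  have hsub : S ⊆ Metric.closedBall 0 (power V₀ Q₀) := by
    rintro ⟨V, Q⟩ ⟨hf, hp⟩
    have hV0 (k : κ) : 0 ≤ (trace (V k : Matrix ι ι ℂ)).re := trace_re_nonneg (hf.posSemidef_V k)
    have hQ0 : 0 ≤ (trace (Q : Matrix ι ι ℂ)).re := trace_re_nonneg hf.posSemidef_Q
    have hsum := Finset.sum_nonneg fun k (_ : k ∈ Finset.univ) => hV0 k
    have hV (k : κ) : (trace (V k : Matrix ι ι ℂ)).re ≤ power V₀ Q₀ := by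
      have := Finset.single_le_sum (fun k _ => hV0 k) (Finset.mem_univ k)
      exact le_trans (by unfold power; linarith) hp
    have hQ : (trace (Q : Matrix ι ι ℂ)).re ≤ power V₀ Q₀ :=
      le_trans (by unfold power; linarith) hp
    have hP : 0 ≤ power V₀ Q₀ := hQ0.trans hQ
    rw [mem_closedBall_zero_iff, Prod.norm_def, max_le_iff]
    refine ⟨?_, ?_⟩
    · refine (pi_norm_le_iff_of_nonneg hP).2 fun k => (pi_norm_le_iff_of_nonneg hP).2 fun i =>
        (pi_norm_le_iff_of_nonneg hP).2 fun j => ?_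
      exact (norm_apply_le_trace (hf.posSemidef_V k) i j).trans (hV k)
    · refine (pi_norm_le_iff_of_nonneg hP).2 fun i => (pi_norm_le_iff_of_nonneg hP).2 fun j => ?_
      exact (norm_apply_le_trace hf.posSemidef_Q i j).trans hQ
  have hcomp : IsCompact S := (isCompact_closedBall _ _).of_isClosed_subset hclosed hsub
  obtain ⟨⟨V, Q⟩, hmem, hmin⟩ := hcomp.exists_isMinOn ⟨(V₀, Q₀), h₀, le_rfl⟩
    (f := fun p => power (p.1 : κ → Matrix ι ι ℂ) p.2) continuous_power.continuousOn
  refine ⟨V, Q, hmem.1, fun V' Q' hf' => ?_⟩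
  rcases le_total (power V' Q') (power V₀ Q₀) with hle | hle
  · exact hmin (show (V', Q') ∈ S from ⟨hf', hle⟩)
  · exact hmem.2.trans hle

lemma IsOptimal.optimalValue_eq (hopt : IsOptimal h γ σ C V Q) :
    optimalValue h γ σ C = ((power V Q : ℝ) : EReal) :=
  le_antisymm (iInf_le_of_le V (iInf_le_of_le Q (iInf_le_of_le hopt.1 le_rfl)))
    (le_iInf fun V' => le_iInf fun Q' => le_iInf fun hf =>
      EReal.coe_le_coe_iff.2 (hopt.2 V' Q' hf))

lemma optimalValue_eq_top (hF : ¬ Feasible h γ σ C) : optimalValue h γ σ C = ⊤ := by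
  refine top_unique (le_iInf fun V => le_iInf fun Q => le_iInf fun hf => ?_)
  exact (hF ⟨V, Q, hf⟩).elim

end Existence

/-! ### Deleting a relay and extending by zero -/

section RemoveRelay

variable {κ ι : Type*} [Fintype κ] [DecidableEq κ] [Fintype ι] [LinearOrder ι]
  {h : κ → ι → ℂ} {γ σ : κ → ℝ} {C : ι → ℝ} {V : κ → Matrix ι ι ℂ} {Q : Matrix ι ι ℂ}

/-- The matrix of the inclusion of the relays other than `r`. -/
def inclusionMat (r : ι) : Matrix ι {m : ι // m ≠ r} ℂ :=
  Matrix.of fun i j => if i = j then 1 else 0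

/-- Extension of a matrix by a zero row and column at `r`. -/
def extendZero (r : ι) (A : Matrix {m : ι // m ≠ r} {m : ι // m ≠ r} ℂ) : Matrix ι ι ℂ :=
  inclusionMat r * A * (inclusionMat r)ᴴ

lemma inclusionMat_conjTranspose_mulVec (r : ι) (x : ι → ℂ) :
    (inclusionMat r)ᴴ *ᵥ x = fun j : {m : ι // m ≠ r} => x j := by
  ext j
  simp [inclusionMat, mulVec, dotProduct, apply_ite]

variable {r : ι}

lemma quadForm_extendZero (A : Matrix {m : ι // m ≠ r} {m : ι // m ≠ r} ℂ) (x : ι → ℂ) :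
    quadForm (extendZero r A) x = quadForm A fun j : {m : ι // m ≠ r} => x j := by
  rw [extendZero, quadForm_congr, inclusionMat_conjTranspose_mulVec]

lemma extendZero_self (A : Matrix {m : ι // m ≠ r} {m : ι // m ≠ r} ℂ) :
    extendZero r A r r = 0 := by
  have h1 (j : {m : ι // m ≠ r}) : r ≠ j := fun hj => j.2 hj.symm
  rw [extendZero, Matrix.mul_assoc, mul_apply]
  simp [inclusionMat, h1]

lemma extendZero_diag_re (A : Matrix {m : ι // m ≠ r} {m : ι // m ≠ r} ℂ)
    (m : {m : ι // m ≠ r}) : (extendZero r A m m).re = (A m m).re := by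
  rw [← quadForm_single, ← quadForm_single, quadForm_extendZero]
  congr 1
  ext j
  simp [Pi.single_apply, Subtype.ext_iff]

lemma extendZero_posSemidef {A : Matrix {m : ι // m ≠ r} {m : ι // m ≠ r} ℂ}
    (hA : A.PosSemidef) : (extendZero r A).PosSemidef :=
  hA.mul_mul_conjTranspose_same _

lemma relayPower_extendZero_self (V : κ → Matrix {m : ι // m ≠ r} {m : ι // m ≠ r} ℂ)
    (Q : Matrix {m : ι // m ≠ r} {m : ι // m ≠ r} ℂ) :
    relayPower (fun k => extendZero r (V k)) (extendZero r Q) r = 0 := by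
  simp [relayPower, extendZero_self]

lemma relayPower_extendZero (V : κ → Matrix {m : ι // m ≠ r} {m : ι // m ≠ r} ℂ)
    (Q : Matrix {m : ι // m ≠ r} {m : ι // m ≠ r} ℂ) (m : {m : ι // m ≠ r}) :
    relayPower (fun k => extendZero r (V k)) (extendZero r Q) m = relayPower V Q m := by
  simp only [relayPower, extendZero_diag_re]

lemma power_extendZero (V : κ → Matrix {m : ι // m ≠ r} {m : ι // m ≠ r} ℂ)
    (Q : Matrix {m : ι // m ≠ r} {m : ι // m ≠ r} ℂ) :
    power (fun k => extendZero r (V k)) (extendZero r Q) = power V Q := by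
  rw [power_eq_sum_relayPower, power_eq_sum_relayPower,
    Fintype.sum_eq_add_sum_subtype_ne _ r, relayPower_extendZero_self, zero_add]
  exact Finset.sum_congr rfl fun m _ => relayPower_extendZero V Q m

/-- A feasible point of the reduced problem is feasible for the full problem. -/
lemma IsFeasible.extendZero {V : κ → Matrix {m : ι // m ≠ r} {m : ι // m ≠ r} ℂ}
    {Q : Matrix {m : ι // m ≠ r} {m : ι // m ≠ r} ℂ}
    (hf : IsFeasible (removeChannel r h) γ σ (removeCapacity r C) V Q) :
    IsFeasible h γ σ C (fun k => extendZero r (V k)) (extendZero r Q) := by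
  obtain ⟨hV, hQ, hs, hfr⟩ := isFeasible_iff.1 hf
  refine isFeasible_iff.2 ⟨fun k => extendZero_posSemidef (hV k), extendZero_posSemidef hQ,
    fun k => ?_, fun m x => ?_⟩
  · have h1 := hs k
    simp only [sinrFun, quadForm_extendZero] at h1 ⊢
    exact h1
  · rw [quadForm_extendZero]
    by_cases hm : m = r
    · subst hm
      rw [relayPower_extendZero_self, zero_mul]
      exact mul_nonneg (by positivity) (quadForm_nonneg hQ _)
    · rw [relayPower_extendZero V Q ⟨m, hm⟩]
      exact hfr ⟨m, hm⟩ fun j => x j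

/-- A relay without channels can be switched off: it has no quantization noise at an optimum. -/
lemma IsOptimal.diag_re_eq_zero (hopt : IsOptimal h γ σ C V Q) {r : ι} (hr : ∀ k, h k r = 0) :
    (Q r r).re = 0 := by
  obtain ⟨hV, hQ, hs, hfr⟩ := isFeasible_iff.1 hopt.1
  -- Compressing by `D` erases relay `r`: received powers do not change, since the channels vanish
  -- there, and optimality then forces relay `r`'s power to be zero.
  set D : Matrix ι ι ℂ := diagonal fun m => if m = r then 0 else 1 with hD
  have hDx (x : ι → ℂ) : Dᴴ *ᵥ x = Function.update x r 0 := by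
    ext m
    by_cases hm : m = r
    · subst hm; simp [hD, diagonal_conjTranspose, mulVec_diagonal]
    · simp [hD, diagonal_conjTranspose, mulVec_diagonal, hm]
  have hq (A : Matrix ι ι ℂ) (x : ι → ℂ) :
      quadForm (D * A * Dᴴ) x = quadForm A (Function.update x r 0) := by
    rw [quadForm_congr, hDx]
  have hdiag (A : Matrix ι ι ℂ) (m : ι) (hm : m ≠ r) : ((D * A * Dᴴ) m m).re = (A m m).re := by
    rw [← quadForm_single, hq, ← quadForm_single, Function.update_eq_self_iff.2]
    simp [hm.symm]
  have hdiagr (A : Matrix ι ι ℂ) : ((D * A * Dᴴ) r r).re = 0 := by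
    rw [← quadForm_single, hq]
    have : Function.update (Pi.single r 1 : ι → ℂ) r 0 = 0 := by simp [Pi.single]
    simp [this, quadForm]
  have hRr : relayPower (fun k => D * V k * Dᴴ) (D * Q * Dᴴ) r = 0 := by
    simp [relayPower, hdiagr]
  have hRm (m : ι) (hm : m ≠ r) :
      relayPower (fun k => D * V k * Dᴴ) (D * Q * Dᴴ) m = relayPower V Q m := by
    simp only [relayPower, hdiag _ m hm]
  have hf : IsFeasible h γ σ C (fun k => D * V k * Dᴴ) (D * Q * Dᴴ) := by
    refine isFeasible_iff.2 ⟨fun k => (hV k).mul_mul_conjTranspose_same _,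
      hQ.mul_mul_conjTranspose_same _, fun k => ?_, fun m x => ?_⟩
    · have h1 : Function.update (channelVec h k) r 0 = channelVec h k :=
        Function.update_eq_self_iff.2 (by simp [channelVec, hr])
      have h2 := hs k
      simp only [sinrFun, hq, h1] at h2 ⊢
      exact h2
    · rw [hq]
      by_cases hm : m = r
      · subst hm
        rw [hRr, zero_mul]
        exact mul_nonneg (by positivity) (quadForm_nonneg hQ _)
      · have h1 := hfr m (Function.update x r 0)
        -- Masking commutes with zeroing entry `r`, so the old constraint at the zeroed test vector
        -- is the new one at `x`.
        have h2 : maskFrom m (Function.update x r 0) = Function.update (maskFrom m x) r 0 := by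
          ext i
          by_cases hi : i = r
          · subst hi; simp [maskFrom]
          · simp [maskFrom, hi]
        rw [h2, Function.update_of_ne hm] at h1
        rwa [hRm m hm]
  have h1 := hopt.2 _ _ hf
  rw [power_eq_sum_relayPower, power_eq_sum_relayPower,
    ← Finset.add_sum_erase _ (relayPower V Q) (Finset.mem_univ r),
    ← Finset.add_sum_erase _ (relayPower (fun k => D * V k * Dᴴ) _) (Finset.mem_univ r), hRr,
    Finset.sum_congr rfl fun m hm => hRm m (Finset.ne_of_mem_erase hm)] at h1
  have h2 : 0 ≤ ∑ k, (V k r r).re := Finset.sum_nonneg fun k _ => diag_re_nonneg (hV k) r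
  have h3 : relayPower V Q r = ∑ k, (V k r r).re + (Q r r).re := rfl
  have h4 := diag_re_nonneg hQ r
  linarith

end RemoveRelay

end RelaySDR

theorem mainTheorem4 {M K : ℕ} (hK : 0 < K)
    -- SINR targets, noise standard deviations and fronthaul capacities
    (γ σ : Fin K → ℝ) (C : Fin M → ℝ)
    (hγ : ∀ k, 0 < γ k) (hσ : ∀ k, 0 < σ k) (hC : ∀ m, 0 < C m)
    -- the relay that is removed in the reduced problem (R)
    (r : Fin M)
    -- the random channels
    {Ω : Type*} [MeasurableSpace Ω] (μ : MeasureTheory.Measure Ω)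
    [MeasureTheory.IsProbabilityMeasure μ]
    (h : Ω → Fin K → Fin M → ℂ)
    (h_meas : ∀ k m, Measurable fun ω => h ω k m)
    (h_indep : ProbabilityTheory.IndepFun (fun ω k => h ω k r)
      (fun ω => RelaySDR.removeChannel r (h ω)) μ)
    (h_ne : ∀ᵐ ω ∂μ, ∃ k, h ω k r ≠ 0) :
    ∀ᵐ ω ∂μ,
      (∀ V Q, RelaySDR.IsOptimal (RelaySDR.removeChannel r (h ω)) γ σ
          (RelaySDR.removeCapacity r C) V Q → Q.PosDef) →
        (RelaySDR.Feasible (h ω) γ σ C →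
          RelaySDR.optimalValue (RelaySDR.removeChannel r (h ω)) γ σ (RelaySDR.removeCapacity r C)
            ≠ RelaySDR.optimalValue (h ω) γ σ C) ∧
        (RelaySDR.Feasible (RelaySDR.removeChannel r (h ω)) γ σ (RelaySDR.removeCapacity r C) →
          ∀ V Q, RelaySDR.IsOptimal (h ω) γ σ C V Q → Q.PosDef) := by
  filter_upwards [h_ne] with ω ⟨k, hk⟩ hpd
  refine ⟨fun hF heq => ?_, fun hR V Q hopt => hopt.1.posDef fun m hm => ?_⟩
  · obtain ⟨V, Q, hopt⟩ := hF.exists_isOptimal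
    rw [hopt.optimalValue_eq] at heq
    by_cases hR : RelaySDR.Feasible (RelaySDR.removeChannel r (h ω)) γ σ
        (RelaySDR.removeCapacity r C)
    · obtain ⟨V', Q', hopt'⟩ := hR.exists_isOptimal
      rw [hopt'.optimalValue_eq, EReal.coe_eq_coe_iff, ← RelaySDR.power_extendZero] at heq
      -- Equal optimal values make the zero-extended optimum of (R) optimal in the SDR, although
      -- relay `r` is silent in it.
      have hopt'' : RelaySDR.IsOptimal (h ω) γ σ C _ _ :=
        ⟨hopt'.1.extendZero, fun W P hf => heq.le.trans (hopt.2 W P hf)⟩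
      exact hk (hopt''.channel_eq_zero hγ hσ (hC r) (RelaySDR.extendZero_self Q') k)
    · rw [RelaySDR.optimalValue_eq_top hR] at heq
      exact EReal.coe_ne_top _ heq.symm
  · have hch := hopt.channel_eq_zero hγ hσ (hC m) hm
    -- Relay `r` reaches some user, so the silent relay `m` survives in (R).
    have hmr : m ≠ r := fun hmr => hk (hmr ▸ hch k)
    obtain ⟨V', Q', hopt'⟩ := hR.exists_isOptimal
    have hpos := (Complex.pos_iff.1 ((hpd V' Q' hopt').diag_pos (i := ⟨m, hmr⟩))).1
    exact hpos.ne' (hopt'.diag_re_eq_zero fun j => hch j)
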